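/- Let $\mathcal X$ be a finite set and let $q=q_{X,Y}$ be a probability mass function on $\mathcal X\times\mathcal X$ such that $X=Y$ almost surely under $q$. Consider the following two-processor simulation problem with an omniscient coordinator. For real rates $R,R_1,R_2\ge 0$ and a block length $n$, let $W_1,W_2$ be independent, with $W_i$ uniformly distributed on $[1:2^{nR_i}]$, where $[1:2^{a}]$ denotes the set of integers $m$ with $1\le m\le 2^{a}$. An $(n,2^{nR},2^{nR_1},2^{nR_2})$ simulation code consists of conditional probability mass functions $p(m|w_1,w_2)$, $p(x^n|m,w_1)$ and $p(y^n|m,w_2)$, with $m\in[1:2^{nR}]$, $w_i\in[1:2^{nR_i}]$ and $x^n,y^n\in\mathcal X^n$: the coordinator observes $(W_1,W_2)$ and sends a common message $M$ to both processors, and the first (second) processor, which sees only $M$ and $W_1$ (only $M$ and $W_2$), outputs $X^n$ ($Y^n$). The induced distribution of the outputs is $$p^{\mathrm{(induced)}}_{X^n,Y^n}(x^n,y^n)=\frac{1}{|[1:2^{nR_1}]|\,|[1:2^{nR_2}]|}\sum_{w_1,w_2,m}p(m|w_1,w_2)\,p(x^n|m,w_1)\,p(y^n|m,w_2).$$ A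 triple $(R,R_1,R_2)$ of non-negative reals is achievable if there is a sequence of $(n,2^{nR},2^{nR_1},2^{nR_2})$ simulation codes such that $$\lim_{n\to\infty}\bigl\|p^{\mathrm{(induced)}}_{X^n,Y^n}-q^{(n)}_{X,Y}\bigr\|_1=0,\qquad q^{(n)}_{X,Y}(x^n,y^n)=\prod_{i=1}^n q(x_i,y_i),$$ and the simulation rate region is the closure in $\mathbb R^3$ of the set of achievable triples. Theorem. The simulation rate region is the set of all triples $(R,R_1,R_2)$ of non-negative real numbers such that $$R+\min\{R_1,R_2\}\ge H(X)\qquad\text{and}\qquad R\ge \frac{H(X)}{2},$$ where $H(X)$ is the Shannon entropy, in bits, of the marginal of $X$ under $q$. -/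

import Mathlib

open Filter Topology

namespace DistributedSampling

noncomputable section

/-- The size of the index set `[1 : 2^{nR}]`, that is, the number of integers `m` with
`1 ≤ m ≤ 2^{nR}`. -/
def indexSize (n : ℕ) (R : ℝ) : ℕ := ⌊(2 : ℝ) ^ ((n : ℝ) * R)⌋₊

/-- The set `[1 : 2^{nR}]`, relabelled to start at zero. -/
abbrev Index (n : ℕ) (R : ℝ) : Type := Fin (indexSize n R)

/-- An `(n, 2^{nR}, 2^{nR₁}, 2^{nR₂})` simulation code for a coordinator that sees both sources of
shared randomness `W₁, W₂` and two processors, where processor `i` sees the common message and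
`Wᵢ` only. All three maps are random maps, which models private randomization. -/
structure SimulationCode (α β : Type*) (n : ℕ) (R R₁ R₂ : ℝ) where
  /-- The conditional law `p(m | w₁, w₂)` of the coordinator's message. -/
  coordinator : Index n R₁ → Index n R₂ → PMF (Index n R)
  /-- The conditional law `p(xⁿ | m, w₁)` of the output of processor 1. -/
  processor₁ : Index n R → Index n R₁ → PMF (Fin n → α)
  /-- The conditional law `p(yⁿ | m, w₂)` of the output of processor 2. -/
  processor₂ : Index n R → Index n R₂ → PMF (Fin n → β)

/-- The induced probability mass `p(xⁿ, yⁿ)` of a pair of outputs, when `W₁` and `W₂` are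
independent and uniformly distributed on their index sets. -/
def SimulationCode.induced {α β : Type*} {n : ℕ} {R R₁ R₂ : ℝ}
    (c : SimulationCode α β n R R₁ R₂) (x : Fin n → α) (y : Fin n → β) : ℝ :=
  ∑ w₁ : Index n R₁, ∑ w₂ : Index n R₂, ∑ m : Index n R,
    (c.coordinator w₁ w₂ m).toReal * (c.processor₁ m w₁ x).toReal * (c.processor₂ m w₂ y).toReal
      / ((indexSize n R₁ : ℝ) * (indexSize n R₂ : ℝ))

/-- The i.i.d. probability mass `∏ᵢ q(xᵢ, yᵢ)`. -/
def iidMass {α β : Type*} (q : PMF (α × β)) {n : ℕ} (x : Fin n → α) (y : Fin n → β) : ℝ :=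
  ∏ i, (q (x i, y i)).toReal

/-- The `ℓ¹` distance between the induced distribution of a code and the i.i.d. distribution. -/
def SimulationCode.l1Error {α β : Type*} [Fintype α] [Fintype β] {n : ℕ} {R R₁ R₂ : ℝ}
    (c : SimulationCode α β n R R₁ R₂) (q : PMF (α × β)) : ℝ :=
  ∑ x : Fin n → α, ∑ y : Fin n → β, |c.induced x y - iidMass q x y|

/-- The rate triple `(R, R₁, R₂)` is achievable for `q`: rates are non-negative, and there is a
sequence of simulation codes, one for each block length `n`, with vanishing `ℓ¹` error. -/
def Achievable {α β : Type*} [Fintype α] [Fintype β] (q : PMF (α × β)) (R R₁ R₂ : ℝ) : Prop :=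
  0 ≤ R ∧ 0 ≤ R₁ ∧ 0 ≤ R₂ ∧
    ∃ c : (n : ℕ) → SimulationCode α β n R R₁ R₂,
      Tendsto (fun n => (c n).l1Error q) atTop (𝓝 0)

/-- The simulation rate region: the closure of the set of achievable triples `(R, R₁, R₂)`. -/
def simulationRateRegion {α β : Type*} [Fintype α] [Fintype β] (q : PMF (α × β)) :
    Set (ℝ × ℝ × ℝ) :=
  closure {r | Achievable q r.1 r.2.1 r.2.2}

/-- Shannon entropy in bits. A term with `p a = 0` contributes `0`. -/
def entropy {α : Type*} [Fintype α] (p : PMF α) : ℝ :=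
  -∑ a, (p a).toReal * Real.logb 2 (p a).toReal

end

end DistributedSampling

/-! Converse. Let `r` be the induced mass on the diagonal and `p` the i.i.d. mass; the quantity that
governs everything is `∑ √r`. If `r` is `ℓ¹`-close to `p`, it must be large: nearly all of `p` lies
on words of mass at most `2^(-nh)`, for any `h < H`, and `sum_light_le` then forces `∑ √r` to be of
order at least `2^(nh/2)`. On the other hand it is small for any code, by Cauchy–Schwarz
(`sum_sqrt_sum_mul_le`). Given a message, the outputs are driven by independent `W₁`, `W₂`, so `∑ √r
≤ 2^(nR)`, whence `H/2 ≤ R`; splitting by the pair of message and `Wᵢ` gives `∑ √r ≤ 2^(n(R+Rᵢ)/2)`,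
whence `H ≤ R + Rᵢ`. No entropy inequalities are needed.

Achievability. Put `t = min R (min R₁ R₂)` and extract from each `Wᵢ` an element `gᵢ` of a cyclic
group of order about `2^(nt)`. The message carries `g₁ + g₂`, at rate `t`, and fresh uniform bits
`V` at rate `R - t + ε`. Each processor subtracts its own share, so both know `(g₁, g₂, V)`: nearly
uniform common randomness at rate `R + t + ε ≥ H + ε`. Mapping it greedily onto typical words
(`exists_map_sum_abs_sub_le`) approximates the source. -/

namespace DistributedSampling

/-! ### Large deviations and typical words -/

/-- The sum over all words of a product of letterwise weights is a power. -/
theorem sum_prod_eq_pow {α : Type*} [Fintype α] (h : α → ℝ) (n : ℕ) :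
    ∑ x : Fin n → α, ∏ i, h (x i) = (∑ a, h a) ^ n := by
  classical
  rw [Finset.sum_pow', Fintype.piFinset_univ]

/-- An exponential moment of a function of negative mean drops below one. -/
theorem exists_exponential_moment_lt_one {α : Type*} [Fintype α] {p : α → ℝ} (hp1 : ∑ a, p a = 1)
    {g : α → ℝ} {c : ℝ} (hc : ∑ a, p a * g a < c) :
    ∃ s : ℝ, 0 < s ∧ ∑ a, p a * Real.exp (s * (g a - c)) < 1 := by
  -- The moment equals 1 at `s = 0` and has negative derivative there, so it is below 1 for some
  -- small `s > 0`.
  have hd : HasDerivAt (fun s : ℝ => ∑ a, p a * Real.exp (s * (g a - c)))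
      (∑ a, p a * (g a - c)) 0 := by
    refine HasDerivAt.fun_sum fun a _ => ?_
    have h := ((((hasDerivAt_id (0 : ℝ)).mul_const (g a - c)).exp).const_mul (p a))
    simpa using h
  have hneg : ∑ a, p a * (g a - c) < 0 := by
    simp only [mul_sub, Finset.sum_sub_distrib, ← Finset.sum_mul, hp1]
    linarith
  have hslope := (hasDerivAt_iff_tendsto_slope_zero.1 hd).mono_left
    (nhdsWithin_mono (0 : ℝ) (t := {0}ᶜ) (s := Set.Ioi 0) fun x hx => ne_of_gt hx)
  obtain ⟨s, hs, hs0⟩ := ((hslope.eventually (gt_mem_nhds hneg)).and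
    (self_mem_nhdsWithin)).exists
  refine ⟨s, hs0, ?_⟩
  have hs0' : 0 < s := hs0
  simp only [zero_add, zero_mul, Real.exp_zero, mul_one, hp1, smul_eq_mul] at hs
  have := mul_neg_of_pos_of_neg hs0' hs
  rw [mul_inv_cancel_left₀ hs0'.ne'] at this
  linarith

/-- Weak law of large numbers, upper tail, for a product mass function on a finite alphabet. -/
theorem tendsto_sum_upper_tail {α : Type*} [Fintype α] {p : α → ℝ} (hp0 : ∀ a, 0 ≤ p a)
    (hp1 : ∑ a, p a = 1) {g : α → ℝ} {c : ℝ} (hc : ∑ a, p a * g a < c) :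
    Tendsto (fun n : ℕ => ∑ x : Fin n → α with n * c ≤ ∑ i, g (x i), ∏ i, p (x i))
      atTop (𝓝 0) := by
  obtain ⟨s, hs, hlt⟩ := exists_exponential_moment_lt_one hp1 hc
  have h0 : 0 ≤ ∑ a, p a * Real.exp (s * (g a - c)) :=
    Finset.sum_nonneg fun a _ => mul_nonneg (hp0 a) (Real.exp_pos _).le
  refine squeeze_zero (fun n => Finset.sum_nonneg fun x _ => Finset.prod_nonneg fun i _ => hp0 _)
    (fun n => ?_) (tendsto_pow_atTop_nhds_zero_of_lt_one h0 hlt)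
  -- Chernoff bound: on the tail the exponential weight is at least 1.
  rw [← sum_prod_eq_pow]
  refine (Finset.sum_le_sum fun x hx => ?_).trans (Finset.sum_le_sum_of_subset_of_nonneg
    (Finset.filter_subset _ _) fun x _ _ => Finset.prod_nonneg fun i _ =>
      mul_nonneg (hp0 _) (Real.exp_pos _).le)
  rw [Finset.prod_mul_distrib, ← Real.exp_sum, ← Finset.mul_sum]
  refine le_mul_of_one_le_right (Finset.prod_nonneg fun i _ => hp0 _) (Real.one_le_exp ?_)
  have := (Finset.mem_filter.1 hx).2
  refine mul_nonneg hs.le ?_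
  simp only [Finset.sum_sub_distrib, Finset.sum_const, Finset.card_univ, Fintype.card_fin,
    nsmul_eq_mul]
  linarith

/-- Words whose probability is below `2 ^ (-n (H + ε))` have vanishing total probability. -/
theorem tendsto_sum_light_words {α : Type*} [Fintype α] {p : α → ℝ} (hp0 : ∀ a, 0 ≤ p a)
    (hp1 : ∑ a, p a = 1) {c : ℝ} (hc : -∑ a, p a * Real.logb 2 (p a) < c) :
    Tendsto (fun n : ℕ => ∑ x : Fin n → α with ∏ i, p (x i) < (2 : ℝ) ^ (-(n * c)),
      ∏ i, p (x i)) atTop (𝓝 0) := by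
  have h := tendsto_sum_upper_tail hp0 hp1 (g := fun a => -Real.logb 2 (p a)) (c := c)
    (by simpa using hc)
  have hnn : ∀ (n : ℕ) (x : Fin n → α), 0 ≤ ∏ i, p (x i) :=
    fun n x => Finset.prod_nonneg fun i _ => hp0 _
  refine squeeze_zero (fun n => Finset.sum_nonneg fun x _ => hnn n x) (fun n => ?_) h
  -- Words of mass zero are discarded first, since the logarithm of a product splits only over
  -- nonzero factors.
  rw [← Finset.sum_filter_ne_zero]
  refine Finset.sum_le_sum_of_subset_of_nonneg (fun x hx => ?_) fun x _ _ => hnn n x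
  obtain ⟨hx, hne⟩ := Finset.mem_filter.1 hx
  have hpos : 0 < ∏ i, p (x i) := (hnn n x).lt_of_ne' hne
  simp only [Finset.mem_filter, Finset.mem_univ, true_and] at hx ⊢
  have hl := Real.logb_lt_logb one_lt_two hpos hx
  rw [Real.logb_rpow two_pos (by norm_num), Real.logb_prod _ _
    (fun i _ => Finset.prod_ne_zero_iff.1 hne i (Finset.mem_univ _))] at hl
  rw [Finset.sum_neg_distrib]
  linarith

/-- Words whose probability exceeds `2 ^ (-n (H - ε))` have vanishing total probability. -/
theorem tendsto_sum_heavy_words {α : Type*} [Fintype α] {p : α → ℝ} (hp0 : ∀ a, 0 ≤ p a)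
    (hp1 : ∑ a, p a = 1) {c : ℝ} (hc : c < -∑ a, p a * Real.logb 2 (p a)) :
    Tendsto (fun n : ℕ => ∑ x : Fin n → α with (2 : ℝ) ^ (-(n * c)) < ∏ i, p (x i),
      ∏ i, p (x i)) atTop (𝓝 0) := by
  have h := tendsto_sum_upper_tail hp0 hp1 (g := fun a => Real.logb 2 (p a)) (c := -c)
    (by linarith)
  have hnn : ∀ (n : ℕ) (x : Fin n → α), 0 ≤ ∏ i, p (x i) :=
    fun n x => Finset.prod_nonneg fun i _ => hp0 _
  refine squeeze_zero (fun n => Finset.sum_nonneg fun x _ => hnn n x) (fun n => ?_) h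
  rw [← Finset.sum_filter_ne_zero]
  refine Finset.sum_le_sum_of_subset_of_nonneg (fun x hx => ?_) fun x _ _ => hnn n x
  obtain ⟨hx, hne⟩ := Finset.mem_filter.1 hx
  simp only [Finset.mem_filter, Finset.mem_univ, true_and] at hx ⊢
  have hl := Real.logb_lt_logb one_lt_two (by positivity) hx
  rw [Real.logb_rpow two_pos (by norm_num), Real.logb_prod _ _
    (fun i _ => Finset.prod_ne_zero_iff.1 hne i (Finset.mem_univ _))] at hl
  linarith

/-! ### Greedy quantization -/

/-- Greedy quantization: if all atoms of a mass function `u` are at most `δ`, some image of `u`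
approximates a given mass function `p` in `ℓ¹`, with an error governed by `δ` times the size of
a set `T` carrying most of the mass of `p`. -/
theorem exists_map_sum_abs_sub_le {A S : Type*} [Fintype A] [Fintype S] [Nonempty S]
    [DecidableEq S] {u : A → ℝ} {p : S → ℝ} (hu0 : ∀ a, 0 ≤ u a) (hu1 : ∑ a, u a = 1)
    (hp0 : ∀ s, 0 ≤ p s) (hp1 : ∑ s, p s = 1) {δ : ℝ} (hδ : ∀ a, u a ≤ δ)
    (T : Finset S) :
    ∃ f : A → S, ∑ s, |(∑ a with f a = s, u a) - p s| ≤
      2 * (T.card * δ + ∑ s with s ∉ T, p s) := by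
  classical
  -- Partial assignments that overfill no `s`; a maximal one is chosen.
  let good : Finset (A → Option S) :=
    {g | ∀ s, ∑ a with g a = some s, u a ≤ p s}
  have hgood : good.Nonempty := ⟨fun _ => none, by simp [good, hp0]⟩
  obtain ⟨g, hg, hmax⟩ := good.exists_max_image
    (fun g => (Finset.univ.filter fun a => g a ≠ none).card) hgood
  have hg' : ∀ s, ∑ a with g a = some s, u a ≤ p s := by simpa [good] using hg
  have hδ0 : 0 ≤ δ := by
    by_contra h
    have : ∑ a, u a ≤ 0 := Finset.sum_nonpos fun a _ => (hδ a).trans (not_le.1 h).le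
    linarith
  -- If an atom is left over, a deficit above `δ` could absorb it, against maximality. If none is
  -- left, the nonnegative deficits sum to zero.
  have hdef : ∀ s, p s - ∑ a with g a = some s, u a ≤ δ := by
    intro s
    by_cases hall : ∃ a, g a = none
    · obtain ⟨a, ha⟩ := hall
      by_contra hs
      rw [not_le] at hs
      have hmem : Function.update g a (some s) ∈ good := by
        simp only [good, Finset.mem_filter, Finset.mem_univ, true_and]
        intro s'
        by_cases hss : s' = s
        · subst hss
          have hsub : (Finset.univ.filter fun b => Function.update g a (some s') b = some s') =
              insert a (Finset.univ.filter fun b => g b = some s') := by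
            ext b
            by_cases hb : b = a <;> simp [Function.update_apply, hb]
          rw [hsub, Finset.sum_insert (by simp [ha])]
          linarith [hδ a]
        · refine le_trans (le_of_eq (Finset.sum_congr ?_ fun _ _ => rfl)) (hg' s')
          ext b
          by_cases hb : b = a <;> simp [Function.update_apply, hb, ha, Ne.symm hss]
      have hcard := hmax _ hmem
      refine absurd hcard (not_le.2 (Finset.card_lt_card ?_))
      refine Finset.ssubset_iff_of_subset (fun b hb => ?_) |>.2 ⟨a, by simp, by simp [ha]⟩
      by_cases hba : b = a
      · simp [hba]
      · simpa [Function.update_apply, hba] using hb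
    · push Not at hall
      have htot : ∑ s, ∑ a with g a = some s, u a = 1 := by
        rw [← hu1, ← Finset.sum_fiberwise (s := Finset.univ) (g := g) (f := u),
          Fintype.sum_option]
        simp [hall]
      have hz : ∑ s, (p s - ∑ a with g a = some s, u a) = 0 := by
        rw [Finset.sum_sub_distrib, htot, hp1, sub_self]
      rw [(Finset.sum_eq_zero_iff_of_nonneg fun s _ => sub_nonneg.2 (hg' s)).1 hz s
        (Finset.mem_univ _)]
      exact hδ0
  let f : A → S := fun a => (g a).getD (Classical.arbitrary S)
  have hge : ∀ s, ∑ a with g a = some s, u a ≤ ∑ a with f a = s, u a := fun s =>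
    Finset.sum_le_sum_of_subset_of_nonneg (fun a ha => by
      simp only [Finset.mem_filter, Finset.mem_univ, true_and] at ha
      simp [f, ha]) fun a _ _ => hu0 a
  refine ⟨f, ?_⟩
  have hf1 : ∑ s, ∑ a with f a = s, u a = 1 := by
    rw [← hu1, ← Finset.sum_fiberwise (s := Finset.univ) (g := f) (f := u)]
  -- The absolute value is the signed difference plus twice its negative part. The signed
  -- differences cancel in the sum, and the negative part is at most both `δ` and `p s`.
  have hpoint : ∀ s, |(∑ a with f a = s, u a) - p s| ≤
      ((∑ a with f a = s, u a) - p s) + 2 * (if s ∈ T then δ else p s) := by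
    intro s
    have h1 := hge s
    have h2 := hdef s
    have h3 : 0 ≤ ∑ a with f a = s, u a := Finset.sum_nonneg fun a _ => hu0 a
    have h4 := hp0 s
    rw [abs_le]
    split_ifs <;> constructor <;> linarith
  refine (Finset.sum_le_sum fun s _ => hpoint s).trans (le_of_eq ?_)
  rw [Finset.sum_add_distrib, Finset.sum_sub_distrib, hf1, hp1, ← Finset.mul_sum, Finset.sum_ite]
  simp

/-! ### Mass functions and index sizes -/

theorem PMF.sum_toReal {β : Type*} [Fintype β] (p : PMF β) : ∑ b, (p b).toReal = 1 := by
  rw [← ENNReal.toReal_sum fun b _ => p.apply_ne_top b, ← tsum_fintype (L := .unconditional β),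
    p.tsum_coe, ENNReal.toReal_one]

theorem PMF.toReal_le_one {β : Type*} (p : PMF β) (b : β) : (p b).toReal ≤ 1 :=
  ENNReal.toReal_le_of_le_ofReal zero_le_one (by simpa using p.coe_le_one b)

theorem indexSize_pos {n : ℕ} {R : ℝ} (hR : 0 ≤ R) : 0 < indexSize n R :=
  Nat.floor_pos.2 (Real.one_le_rpow one_le_two (by positivity))

theorem indexSize_le (n : ℕ) (R : ℝ) : (indexSize n R : ℝ) ≤ 2 ^ (n * R) :=
  Nat.floor_le (by positivity)

/-- Rounding down a number that is at least 1 loses at most a factor 2. -/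
theorem rpow_le_two_mul_indexSize {n : ℕ} {R : ℝ} (hR : 0 ≤ R) :
    (2 : ℝ) ^ (n * R) ≤ 2 * indexSize n R := by
  have h1 : (2 : ℝ) ^ (n * R) < indexSize n R + 1 := Nat.lt_floor_add_one _
  have h2 : (1 : ℝ) ≤ indexSize n R := by exact_mod_cast indexSize_pos hR
  linarith

/-! ### Converse: bounds on the sum of square roots -/

/-- If two mass functions `p, r` are close, then `p` puts little mass on words that are lighter
than `t`, unless `∑ √r` is of order at least `1 / √t`. -/
theorem sum_light_le {S : Type*} [Fintype S] {p r : S → ℝ} (hp0 : ∀ s, 0 ≤ p s)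
    (hr0 : ∀ s, 0 ≤ r s) {t : ℝ} :
    ∑ s with p s ≤ t, p s ≤ ∑ s, |r s - p s| + √t * ∑ s, √(r s) := by
  rw [Finset.mul_sum, ← Finset.sum_add_distrib]
  refine (Finset.sum_le_sum fun s hs => ?_).trans (Finset.sum_le_sum_of_subset_of_nonneg
    (Finset.filter_subset _ _) fun s _ _ => by positivity)
  have ht : p s ≤ t := (Finset.mem_filter.1 hs).2
  have h1 : √(p s) * √(r s) ≤ √t * √(r s) := by gcongr
  have h2 : p s - r s ≤ |r s - p s| := by rw [abs_sub_comm]; exact le_abs_self _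
  have h3 := abs_nonneg (r s - p s)
  have hp := Real.mul_self_sqrt (hp0 s)
  have hr := Real.mul_self_sqrt (hr0 s)
  -- Either `p ≤ √p √r`, or `r ≤ √p √r` and the excess `p - r` goes into the `ℓ¹` term.
  rcases le_total (√(p s)) (√(r s)) with h | h
  · have := mul_le_mul_of_nonneg_left h (Real.sqrt_nonneg (p s))
    linarith
  · have := mul_le_mul_of_nonneg_right h (Real.sqrt_nonneg (r s))
    linarith

theorem sqrt_sum_le_sum_sqrt {ι : Type*} (s : Finset ι) {a : ι → ℝ} (ha : ∀ i, 0 ≤ a i) :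
    √(∑ i ∈ s, a i) ≤ ∑ i ∈ s, √(a i) := by
  classical
  induction s using Finset.induction_on with
  | empty => simp
  | insert i s hi ih =>
    rw [Finset.sum_insert hi, Finset.sum_insert hi]
    have hs : 0 ≤ ∑ j ∈ s, a j := Finset.sum_nonneg fun j _ => ha j
    refine le_trans (Real.sqrt_le_iff.2 ⟨by positivity, ?_⟩) (add_le_add_right ih (√(a i)))
    rw [add_sq, Real.sq_sqrt (ha i), Real.sq_sqrt hs]
    have := mul_nonneg (Real.sqrt_nonneg (a i)) (Real.sqrt_nonneg (∑ j ∈ s, a j))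
    linarith

/-- Cauchy–Schwarz, with the sum over an index set of products. -/
theorem sum_sqrt_sum_mul_le {ι S : Type*} [Fintype ι] [Fintype S] {a b : ι → S → ℝ}
    (ha : ∀ i s, 0 ≤ a i s) (hb : ∀ i s, 0 ≤ b i s) (ha1 : ∀ i, ∑ s, a i s ≤ 1) :
    ∑ s, √(∑ i, a i s * b i s) ≤ ∑ i, √(∑ s, b i s) := by
  calc ∑ s, √(∑ i, a i s * b i s) ≤ ∑ s, ∑ i, √(a i s * b i s) :=
        Finset.sum_le_sum fun s _ => sqrt_sum_le_sum_sqrt _ fun i => mul_nonneg (ha i s) (hb i s)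
    _ = ∑ i, ∑ s, √(a i s) * √(b i s) := by
        rw [Finset.sum_comm]
        exact Finset.sum_congr rfl fun i _ => Finset.sum_congr rfl fun s _ =>
          Real.sqrt_mul (ha i s) _
    _ ≤ ∑ i, √(∑ s, a i s) * √(∑ s, b i s) :=
        Finset.sum_le_sum fun i _ => Real.sum_sqrt_mul_sqrt_le _ (ha i) (hb i)
    _ ≤ ∑ i, √(∑ s, b i s) := Finset.sum_le_sum fun i _ =>
        mul_le_of_le_one_left (Real.sqrt_nonneg _) (Real.sqrt_le_one.2 (ha1 i))

namespace SimulationCode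

variable {α : Type*} {n : ℕ} {R R₁ R₂ : ℝ}

theorem induced_nonneg (c : SimulationCode α α n R R₁ R₂) (x y : Fin n → α) :
    0 ≤ c.induced x y :=
  Finset.sum_nonneg fun _ _ => Finset.sum_nonneg fun _ _ => Finset.sum_nonneg fun _ _ => by
    positivity

/-- The code with the roles of the two processors exchanged. -/
def swap (c : SimulationCode α α n R R₁ R₂) :
    SimulationCode α α n R R₂ R₁ where
  coordinator w₂ w₁ := c.coordinator w₁ w₂
  processor₁ := c.processor₂
  processor₂ := c.processor₁

theorem swap_induced (c : SimulationCode α α n R R₁ R₂) (x y : Fin n → α) :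
    c.swap.induced x y = c.induced y x := by
  unfold induced
  rw [Finset.sum_comm]
  refine Finset.sum_congr rfl fun w₁ _ => Finset.sum_congr rfl fun w₂ _ =>
    Finset.sum_congr rfl fun m _ => ?_
  simp only [swap]
  ring

variable [Fintype α]

/-- For each of the `2^{nR}` messages `m`, the outputs `p(x|m,W₁)` and `p(y|m,W₂)` are independent,
and the square roots of their coincidence probabilities sum to at most one. -/
theorem sum_sqrt_induced_le_message (hR₁ : 0 ≤ R₁) (hR₂ : 0 ≤ R₂)
    (c : SimulationCode α α n R R₁ R₂) :
    ∑ x, √(c.induced x x) ≤ indexSize n R := by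
  have h₁ : (0 : ℝ) < indexSize n R₁ := by exact_mod_cast indexSize_pos hR₁
  have h₂ : (0 : ℝ) < indexSize n R₂ := by exact_mod_cast indexSize_pos hR₂
  let a : Index n R → (Fin n → α) → ℝ := fun m x =>
    ∑ w, (c.processor₁ m w x).toReal / indexSize n R₁
  let b : Index n R → (Fin n → α) → ℝ := fun m x =>
    ∑ w, (c.processor₂ m w x).toReal / indexSize n R₂
  have ha : ∀ m x, 0 ≤ a m x := fun m x => Finset.sum_nonneg fun w _ => by positivity
  have hb : ∀ m x, 0 ≤ b m x := fun m x => Finset.sum_nonneg fun w _ => by positivity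
  have ha1 : ∀ m, ∑ x, a m x = 1 := fun m => by
    simp only [a]
    rw [Finset.sum_comm]
    simp [← Finset.sum_div, PMF.sum_toReal, h₁.ne']
  have hb1 : ∀ m, ∑ x, b m x = 1 := fun m => by
    simp only [b]
    rw [Finset.sum_comm]
    simp [← Finset.sum_div, PMF.sum_toReal, h₂.ne']
  -- Bounding the coordinator's probability by 1 decouples `w₁` from `w₂`, so the double average
  -- factors.
  have hle : ∀ x, c.induced x x ≤ ∑ m, a m x * b m x := by
    intro x
    have : ∑ m, a m x * b m x = ∑ w₁ : Index n R₁, ∑ w₂ : Index n R₂, ∑ m : Index n R,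
        (c.processor₁ m w₁ x).toReal * (c.processor₂ m w₂ x).toReal /
          ((indexSize n R₁ : ℝ) * indexSize n R₂) := by
      simp only [a, b, Finset.sum_mul_sum, div_mul_div_comm]
      rw [Finset.sum_comm]
      exact Finset.sum_congr rfl fun _ _ => Finset.sum_comm
    rw [this]
    refine Finset.sum_le_sum fun w₁ _ => Finset.sum_le_sum fun w₂ _ =>
      Finset.sum_le_sum fun m _ => ?_
    rw [mul_assoc]
    exact div_le_div_of_nonneg_right
      (mul_le_of_le_one_left (by positivity) (PMF.toReal_le_one _ _)) (by positivity)
  calc ∑ x, √(c.induced x x) ≤ ∑ x, √(∑ m, a m x * b m x) :=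
        Finset.sum_le_sum fun x _ => Real.sqrt_le_sqrt (hle x)
    _ ≤ ∑ m, √(∑ x, b m x) := sum_sqrt_sum_mul_le ha hb fun m => (ha1 m).le
    _ = indexSize n R := by simp [hb1]

/-- The output of processor 1 is produced from one of `2^{nR} 2^{nR₁}` pairs. -/
theorem sum_sqrt_induced_le_processor₁ (hR₁ : 0 ≤ R₁) (hR₂ : 0 ≤ R₂)
    (c : SimulationCode α α n R R₁ R₂) :
    ∑ x, √(c.induced x x) ≤ √(indexSize n R * indexSize n R₁) := by
  have h₁ : (0 : ℝ) < indexSize n R₁ := by exact_mod_cast indexSize_pos hR₁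
  have h₂ : (0 : ℝ) < indexSize n R₂ := by exact_mod_cast indexSize_pos hR₂
  let a : Index n R × Index n R₁ → (Fin n → α) → ℝ := fun i x => (c.processor₁ i.1 i.2 x).toReal
  let b : Index n R × Index n R₁ → (Fin n → α) → ℝ := fun i x =>
    ∑ w₂, (c.coordinator i.2 w₂ i.1).toReal * (c.processor₂ i.1 w₂ x).toReal /
      ((indexSize n R₁ : ℝ) * indexSize n R₂)
  have ha : ∀ i x, 0 ≤ a i x := fun i x => by positivity
  have hb : ∀ i x, 0 ≤ b i x := fun i x => Finset.sum_nonneg fun w _ => by positivity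
  have heq : ∀ x, c.induced x x = ∑ i, a i x * b i x := by
    intro x
    rw [Fintype.sum_prod_type_right]
    refine Finset.sum_congr rfl fun w₁ _ => ?_
    rw [Finset.sum_comm]
    refine Finset.sum_congr rfl fun m _ => ?_
    rw [Finset.mul_sum]
    exact Finset.sum_congr rfl fun w₂ _ => by ring
  have hbsum : ∑ i, ∑ x, b i x = 1 := by
    have hx : ∀ i, ∑ x, b i x = ∑ w₂, (c.coordinator i.2 w₂ i.1).toReal /
        ((indexSize n R₁ : ℝ) * indexSize n R₂) := by
      intro i
      simp only [b]
      rw [Finset.sum_comm]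
      exact Finset.sum_congr rfl fun w _ => by
        rw [← Finset.sum_div, ← Finset.mul_sum, PMF.sum_toReal, mul_one]
    simp only [hx]
    rw [Fintype.sum_prod_type_right]
    calc _ = ∑ w₁ : Index n R₁, ∑ w₂ : Index n R₂, ∑ m : Index n R,
          (c.coordinator w₁ w₂ m).toReal / ((indexSize n R₁ : ℝ) * indexSize n R₂) :=
          Finset.sum_congr rfl fun w₁ _ => Finset.sum_comm
      _ = 1 := by
          simp only [← Finset.sum_div, PMF.sum_toReal]
          simp [h₁.ne', h₂.ne']
  simp only [heq]
  refine (sum_sqrt_sum_mul_le ha hb fun i => (PMF.sum_toReal _).le).trans ?_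
  -- Cauchy–Schwarz against the constant 1: the masses of the pairs `(m, w₁)` sum to 1.
  have h := Real.sum_sqrt_mul_sqrt_le (Finset.univ : Finset (Index n R × Index n R₁))
    (f := fun _ => 1) (g := fun i => ∑ x, b i x) (fun _ => zero_le_one)
    fun i => Finset.sum_nonneg fun x _ => hb i x
  simpa [hbsum] using h

theorem sum_sqrt_induced_le_processor₂ (hR₁ : 0 ≤ R₁) (hR₂ : 0 ≤ R₂)
    (c : SimulationCode α α n R R₁ R₂) :
    ∑ x, √(c.induced x x) ≤ √(indexSize n R * indexSize n R₂) := by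
  simpa [swap_induced] using sum_sqrt_induced_le_processor₁ hR₂ hR₁ c.swap

theorem sum_abs_induced_diag_le (c : SimulationCode α α n R R₁ R₂) (q : PMF (α × α)) :
    ∑ x, |c.induced x x - iidMass q x x| ≤ c.l1Error q :=
  Finset.sum_le_sum fun x _ => Finset.single_le_sum
    (f := fun y => |c.induced x y - iidMass q x y|) (fun _ _ => abs_nonneg _) (Finset.mem_univ x)

end SimulationCode

theorem sum_diag_toReal {α : Type*} [Fintype α] {q : PMF (α × α)}
    (hq : ∀ x y : α, q (x, y) ≠ 0 → x = y) : ∑ a, (q (a, a)).toReal = 1 := by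
  rw [← PMF.sum_toReal q, Fintype.sum_prod_type]
  refine Finset.sum_congr rfl fun a _ => (Fintype.sum_eq_single
    (f := fun b => (q (a, b)).toReal) a fun b hb => ?_).symm
  have : q (a, b) = 0 := by_contra fun h => hb (hq a b h).symm
  simp [this]

theorem entropy_map_fst {α : Type*} [Fintype α] {q : PMF (α × α)}
    (hq : ∀ x y : α, q (x, y) ≠ 0 → x = y) :
    entropy (q.map Prod.fst) =
      -∑ a, (q (a, a)).toReal * Real.logb 2 (q (a, a)).toReal := by
  classical
  have h : ∀ a, (q.map Prod.fst) a = q (a, a) := by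
    intro a
    rw [PMF.map_apply, tsum_eq_single (a, a)]
    · simp
    · rintro ⟨x, y⟩ hxy
      refine ite_eq_right_iff.2 fun hax => by_contra fun hne => hxy ?_
      rw [← hq x y hne, hax]
  simp [entropy, h]

/-- Converse: if `∑ √·` of the induced diagonal is at most `2^{ns}`, then `H / 2 ≤ s`. -/
theorem entropy_le_of_sum_sqrt_le {α : Type*} [Fintype α] {q : PMF (α × α)}
    (hq : ∀ x y : α, q (x, y) ≠ 0 → x = y) {R R₁ R₂ s : ℝ}
    {c : (n : ℕ) → SimulationCode α α n R R₁ R₂}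
    (hc : Tendsto (fun n => (c n).l1Error q) atTop (𝓝 0))
    (hs : ∀ n : ℕ, ∑ x, √((c n).induced x x) ≤ 2 ^ (n * s)) :
    entropy (q.map Prod.fst) / 2 ≤ s := by
  rw [entropy_map_fst hq]
  set H := -∑ a, (q (a, a)).toReal * Real.logb 2 (q (a, a)).toReal with hH
  by_contra hlt
  rw [not_le] at hlt
  have hp1 := sum_diag_toReal hq
  obtain ⟨h, hsh, hhH⟩ := exists_between (show 2 * s < H by linarith)
  have hheavy := tendsto_sum_heavy_words (fun a => ENNReal.toReal_nonneg) hp1 hhH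
  have hpow : Tendsto (fun n : ℕ => ((2 : ℝ) ^ (s - h / 2)) ^ n) atTop (𝓝 0) :=
    tendsto_pow_atTop_nhds_zero_of_lt_one (by positivity)
      (Real.rpow_lt_one_of_one_lt_of_neg one_lt_two (by linarith))
  have hlim := (hheavy.add hc).add hpow
  simp only [add_zero] at hlim
  -- The heavy mass, the code error and the power all vanish, yet for each `n` they add up to at
  -- least the total mass 1.
  refine absurd (ge_of_tendsto' hlim fun n => ?_) (not_le.2 (zero_lt_one (α := ℝ)))
  have htot : ∑ x : Fin n → α, ∏ i, (q (x i, x i)).toReal = 1 := by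
    rw [sum_prod_eq_pow (fun a => (q (a, a)).toReal), hp1, one_pow]
  have hlight := sum_light_le (p := fun x : Fin n → α => ∏ i, (q (x i, x i)).toReal)
    (r := fun x => (c n).induced x x) (t := (2 : ℝ) ^ (-(n * h)))
    (fun x => Finset.prod_nonneg fun i _ => ENNReal.toReal_nonneg)
    (fun x => (c n).induced_nonneg x x)
  have hdiag := (c n).sum_abs_induced_diag_le q
  have hmul : √((2 : ℝ) ^ (-(n * h))) * ∑ x, √((c n).induced x x) ≤
      ((2 : ℝ) ^ (s - h / 2)) ^ n := by
    refine (mul_le_mul_of_nonneg_left (hs n) (Real.sqrt_nonneg _)).trans (le_of_eq ?_)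
    rw [Real.sqrt_eq_rpow, ← Real.rpow_mul two_pos.le, ← Real.rpow_add two_pos,
      ← Real.rpow_natCast, ← Real.rpow_mul two_pos.le]
    ring_nf
  have hsplit : ∑ x : Fin n → α with (2 : ℝ) ^ (-(n * h)) < ∏ i, (q (x i, x i)).toReal,
      ∏ i, (q (x i, x i)).toReal + ∑ x : Fin n → α with
        ∏ i, (q (x i, x i)).toReal ≤ (2 : ℝ) ^ (-(n * h)), ∏ i, (q (x i, x i)).toReal = 1 := by
    rw [← htot, ← Finset.sum_filter_add_sum_filter_not Finset.univ
      (fun x : Fin n → α => (2 : ℝ) ^ (-(n * h)) < ∏ i, (q (x i, x i)).toReal)]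
    congr! 3
    exact not_lt.symm
  simp only [iidMass] at hdiag
  linarith

theorem Achievable.mem_region {α : Type*} [Fintype α] {q : PMF (α × α)}
    (hq : ∀ x y : α, q (x, y) ≠ 0 → x = y) {R R₁ R₂ : ℝ} (h : Achievable q R R₁ R₂) :
    0 ≤ R ∧ 0 ≤ R₁ ∧ 0 ≤ R₂ ∧ entropy (q.map Prod.fst) ≤ R + min R₁ R₂ ∧
      entropy (q.map Prod.fst) / 2 ≤ R := by
  obtain ⟨hR, hR₁, hR₂, c, hc⟩ := h
  have key : ∀ R', ∀ n : ℕ, √((indexSize n R : ℝ) * indexSize n R') ≤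
      2 ^ (n * ((R + R') / 2)) := by
    intro R' n
    rw [Real.sqrt_le_left (by positivity), ← Real.rpow_natCast, ← Real.rpow_mul two_pos.le]
    refine (mul_le_mul (indexSize_le n R) (indexSize_le n R') (Nat.cast_nonneg _)
      (by positivity)).trans (le_of_eq ?_)
    rw [← Real.rpow_add two_pos]
    push_cast
    ring_nf
  have h₁ := entropy_le_of_sum_sqrt_le hq hc fun n =>
    ((c n).sum_sqrt_induced_le_processor₁ hR₁ hR₂).trans (key R₁ n)
  have h₂ := entropy_le_of_sum_sqrt_le hq hc fun n =>
    ((c n).sum_sqrt_induced_le_processor₂ hR₁ hR₂).trans (key R₂ n)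
  have h₀ := entropy_le_of_sum_sqrt_le hq hc fun n =>
    ((c n).sum_sqrt_induced_le_message hR₁ hR₂).trans (indexSize_le n R)
  refine ⟨hR, hR₁, hR₂, ?_, h₀⟩
  rcases min_choice R₁ R₂ with h | h <;> rw [h] <;> linarith

/-! ### Achievability: the sum code -/

theorem PMF.toReal_pure {β : Type*} [DecidableEq β] (b c : β) :
    (PMF.pure b c).toReal = if c = b then 1 else 0 := by
  classical
  rw [PMF.pure_apply]
  split_ifs <;> simp

/-- Expectation of a function under the image of a uniform distribution. -/
theorem PMF.sum_map_uniform_mul {V M : Type*} [Fintype V] [Nonempty V] [Fintype M] (e : V → M)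
    (F : M → ℝ) :
    ∑ m, (((PMF.uniformOfFintype V).map e) m).toReal * F m =
      ∑ v, F (e v) / Fintype.card V := by
  classical
  have h : ∀ m, (((PMF.uniformOfFintype V).map e) m).toReal =
      ∑ v, if m = e v then (Fintype.card V : ℝ)⁻¹ else 0 := by
    intro m
    rw [PMF.map_apply, tsum_fintype, ENNReal.toReal_sum]
    · refine Finset.sum_congr rfl fun v _ => ?_
      split_ifs <;> simp
    · intro v _
      split_ifs <;> simp
  simp only [h, Finset.sum_mul]
  rw [Finset.sum_comm]
  refine Finset.sum_congr rfl fun v _ => ?_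
  rw [Fintype.sum_eq_single (e v) fun m hm => by simp [hm]]
  simp [div_eq_inv_mul]

/-- The code in which both processors recover `(π₁ W₁, π₂ W₂)` from one of the two and the sum
of both, which is part of the message, and output the same function of this pair and of the
remaining, uniform part of the message. -/
noncomputable def SimulationCode.ofSum {α G V : Type*} [AddCommGroup G] [Fintype V] [Nonempty V]
    {n : ℕ} {R R₁ R₂ : ℝ} (π₁ : Index n R₁ → G) (π₂ : Index n R₂ → G)
    (e : V × G → Index n R) (d : Index n R → V × G) (f : G × G × V → Fin n → α) :
    SimulationCode α α n R R₁ R₂ where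
  coordinator w₁ w₂ := (PMF.uniformOfFintype V).map fun v => e (v, π₁ w₁ + π₂ w₂)
  processor₁ m w₁ := PMF.pure (f (π₁ w₁, (d m).2 - π₁ w₁, (d m).1))
  processor₂ m w₂ := PMF.pure (f ((d m).2 - π₂ w₂, π₂ w₂, (d m).1))

theorem SimulationCode.ofSum_induced {α G V : Type*} [DecidableEq α] [AddCommGroup G] [Fintype V]
    [Nonempty V] {n : ℕ} {R R₁ R₂ : ℝ} (π₁ : Index n R₁ → G) (π₂ : Index n R₂ → G)
    {e : V × G → Index n R} {d : Index n R → V × G} (hde : Function.LeftInverse d e)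
    (f : G × G × V → Fin n → α) (x y : Fin n → α) :
    (ofSum π₁ π₂ e d f).induced x y =
      if x = y then ∑ w₁, ∑ w₂, ∑ v, if f (π₁ w₁, π₂ w₂, v) = x then
        ((indexSize n R₁ : ℝ) * indexSize n R₂ * Fintype.card V)⁻¹ else 0
      else 0 := by
  have h : (ofSum π₁ π₂ e d f).induced x y = ∑ w₁, ∑ w₂, ∑ v,
      if x = f (π₁ w₁, π₂ w₂, v) ∧ y = f (π₁ w₁, π₂ w₂, v) then
        ((indexSize n R₁ : ℝ) * indexSize n R₂ * Fintype.card V)⁻¹ else 0 := by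
    unfold induced
    refine Finset.sum_congr rfl fun w₁ _ => Finset.sum_congr rfl fun w₂ _ => ?_
    simp only [mul_assoc, mul_div_assoc]
    rw [ofSum, PMF.sum_map_uniform_mul]
    refine Finset.sum_congr rfl fun v _ => ?_
    simp only [hde _, add_sub_cancel_left, add_sub_cancel_right, PMF.toReal_pure]
    by_cases hx : x = f (π₁ w₁, π₂ w₂, v) <;> by_cases hy : y = f (π₁ w₁, π₂ w₂, v) <;>
      simp [hx, hy]
    ring
  rw [h]
  split_ifs with hxy
  · subst hxy
    simp only [and_self, eq_comm]
  · refine Finset.sum_eq_zero fun _ _ => Finset.sum_eq_zero fun _ _ =>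
      Finset.sum_eq_zero fun _ _ => if_neg fun h => hxy (h.1.trans h.2.symm)

/-- Reduction modulo `k` of a uniform variable on `Fin N` with `k ≤ N` has atoms of at most
`2 / k`. -/
theorem card_filter_mod_le {N k : ℕ} [NeZero k] (hkN : k ≤ N) (g : ZMod k) :
    ((Finset.univ.filter fun w : Fin N => ((w : ℕ) : ZMod k) = g).card : ℝ) / N ≤ 2 / k := by
  have hk : 0 < k := NeZero.pos k
  -- Within one residue class the quotient by `k` determines `w`.
  have hcard : (Finset.univ.filter fun w : Fin N => ((w : ℕ) : ZMod k) = g).card ≤ N / k + 1 := by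
    rw [← Finset.card_range (N / k + 1)]
    refine Finset.card_le_card_of_injOn (fun w => (w : ℕ) / k) (fun w _ => ?_) ?_
    · simpa [Nat.lt_succ_iff] using Nat.div_le_div_right (c := k) w.2.le
    · intro w hw w' hw' h
      simp only [Finset.coe_filter, Finset.mem_univ, true_and, Set.mem_ofPred_eq] at hw hw'
      have hm : (w : ℕ) % k = (w' : ℕ) % k := (ZMod.natCast_eq_natCast_iff' _ _ _).1
        (hw.trans hw'.symm)
      ext
      rw [← Nat.div_add_mod (w : ℕ) k, ← Nat.div_add_mod (w' : ℕ) k, hm]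
      simp only at h
      rw [h]
  have hk' : (0 : ℝ) < k := by exact_mod_cast hk
  have hkN' : (k : ℝ) ≤ N := by exact_mod_cast hkN
  have hcard' : ((Finset.univ.filter fun w : Fin N => ((w : ℕ) : ZMod k) = g).card : ℝ) ≤
      N / k + 1 := by
    refine le_trans (by exact_mod_cast hcard) (add_le_add_left (Nat.cast_div_le (α := ℝ)) 1)
  rw [div_le_div_iff₀ (hk'.trans_le hkN') hk']
  have h2 := mul_le_mul_of_nonneg_right hcard' hk'.le
  rw [add_mul, div_mul_cancel₀ _ hk'.ne'] at h2
  linarith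

/-- Typical words are few. -/
theorem card_heavy_le {S : Type*} [Fintype S] {p : S → ℝ} (hp0 : ∀ s, 0 ≤ p s)
    (hp1 : ∑ s, p s = 1) (c : ℝ) :
    ((Finset.univ.filter fun s => (2 : ℝ) ^ (-c) ≤ p s).card : ℝ) ≤ 2 ^ c := by
  have h : ((Finset.univ.filter fun s => (2 : ℝ) ^ (-c) ≤ p s).card : ℝ) * 2 ^ (-c) ≤ 1 := by
    rw [← hp1, ← nsmul_eq_mul]
    exact (Finset.card_nsmul_le_sum _ _ _ fun s hs => (Finset.mem_filter.1 hs).2).trans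
      (Finset.sum_le_sum_of_subset_of_nonneg (Finset.filter_subset _ _) fun s _ _ => hp0 s)
  have h' := mul_le_mul_of_nonneg_right h (Real.rpow_pos_of_pos two_pos c).le
  rwa [mul_assoc, ← Real.rpow_add two_pos, neg_add_cancel, Real.rpow_zero, mul_one, one_mul] at h'

/-- One-shot achievability: `k` bounds the number of values extracted from each source of shared
randomness, `K` the number of values of the uniform part of the message. -/
theorem exists_code_l1Error_le {α : Type*} [Fintype α] {q : PMF (α × α)}
    (hq : ∀ x y : α, q (x, y) ≠ 0 → x = y) {n k K : ℕ} {R R₁ R₂ : ℝ} (hk : 0 < k) (hK : 0 < K)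
    (hk₁ : k ≤ indexSize n R₁) (hk₂ : k ≤ indexSize n R₂) (hkK : K * k ≤ indexSize n R)
    (T : Finset (Fin n → α)) [DecidablePred (· ∈ T)] :
    ∃ c : SimulationCode α α n R R₁ R₂, c.l1Error q ≤
      2 * (T.card * (4 / (k ^ 2 * K)) + ∑ x with x ∉ T, ∏ i, (q (x i, x i)).toReal) := by
  classical
  have : NeZero k := ⟨hk.ne'⟩
  have : NeZero K := ⟨hK.ne'⟩
  have hp1 := sum_diag_toReal hq
  have hN₁ : (0 : ℝ) < indexSize n R₁ := by exact_mod_cast hk.trans_le hk₁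
  have hN₂ : (0 : ℝ) < indexSize n R₂ := by exact_mod_cast hk.trans_le hk₂
  have hK' : (0 : ℝ) < K := by exact_mod_cast hK
  have hne : Nonempty α := by
    by_contra h
    rw [not_nonempty_iff] at h
    simp at hp1
  obtain ⟨e⟩ : Nonempty (Fin K × ZMod k ↪ Index n R) :=
    Function.Embedding.nonempty_of_card_le (by simpa [ZMod.card] using hkK)
  obtain ⟨d, hd⟩ := e.injective.hasLeftInverse
  let π₁ : Index n R₁ → ZMod k := fun w => ((w : ℕ) : ZMod k)
  let π₂ : Index n R₂ → ZMod k := fun w => ((w : ℕ) : ZMod k)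
  -- The joint law of the two extracted shares and `V`, the common randomness to be quantized.
  let u : ZMod k × ZMod k × Fin K → ℝ := fun a =>
    ((Finset.univ.filter fun w => π₁ w = a.1).card : ℝ) / indexSize n R₁ *
      (((Finset.univ.filter fun w => π₂ w = a.2.1).card : ℝ) / indexSize n R₂) * (K : ℝ)⁻¹
  have hu0 : ∀ a, 0 ≤ u a := fun a => by positivity
  have hu : ∀ F : ZMod k × ZMod k × Fin K → ℝ, ∑ a, u a * F a = ∑ w₁, ∑ w₂, ∑ v,
      ((indexSize n R₁ : ℝ) * indexSize n R₂ * K)⁻¹ * F (π₁ w₁, π₂ w₂, v) := by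
    intro F
    have key : ∀ {N : ℕ} (π : Fin N → ZMod k) (E : ZMod k → ℝ),
        ∑ w, E (π w) = ∑ g, ((Finset.univ.filter fun w => π w = g).card : ℝ) * E g := by
      intro N π E
      rw [← Finset.sum_fiberwise (s := Finset.univ) (g := π)]
      refine Finset.sum_congr rfl fun g _ => ?_
      rw [← nsmul_eq_mul]
      exact Finset.sum_eq_card_nsmul fun w hw => by rw [(Finset.mem_filter.1 hw).2]
    rw [key π₁ fun g => ∑ w₂, ∑ v, ((indexSize n R₁ : ℝ) * indexSize n R₂ * K)⁻¹ *
      F (g, π₂ w₂, v), Fintype.sum_prod_type]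
    refine Finset.sum_congr rfl fun g _ => ?_
    rw [key π₂ fun h => ∑ v, ((indexSize n R₁ : ℝ) * indexSize n R₂ * K)⁻¹ * F (g, h, v),
      Fintype.sum_prod_type, Finset.mul_sum]
    refine Finset.sum_congr rfl fun h _ => ?_
    rw [← mul_assoc, Finset.mul_sum]
    refine Finset.sum_congr rfl fun v _ => ?_
    simp only [u, mul_inv, div_eq_mul_inv]
    ring
  have hu1 : ∑ a, u a = 1 := by
    have h := hu fun _ => 1
    simp only [mul_one] at h
    rw [h]
    simp only [Finset.sum_const, Finset.card_univ, Fintype.card_fin, nsmul_eq_mul]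
    field_simp
  have hδ : ∀ a, u a ≤ 4 / (k ^ 2 * K) := by
    intro a
    have h₁ := card_filter_mod_le hk₁ a.1
    have h₂ := card_filter_mod_le hk₂ a.2.1
    calc u a ≤ 2 / k * (2 / k) * (K : ℝ)⁻¹ := by
          refine mul_le_mul_of_nonneg_right ?_ (by positivity)
          exact mul_le_mul h₁ h₂ (by positivity) (by positivity)
      _ = 4 / (k ^ 2 * K) := by
          field_simp
          norm_num
  obtain ⟨f, hf⟩ := exists_map_sum_abs_sub_le hu0 hu1
    (p := fun x : Fin n → α => ∏ i, (q (x i, x i)).toReal)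
    (fun x => Finset.prod_nonneg fun i _ => ENNReal.toReal_nonneg)
    (by rw [sum_prod_eq_pow (fun a => (q (a, a)).toReal), hp1, one_pow]) hδ T
  refine ⟨SimulationCode.ofSum π₁ π₂ e d f, ?_⟩
  refine le_trans (le_of_eq ?_) (hf.trans (le_of_eq ?_))
  · refine Finset.sum_congr rfl fun x _ => ?_
    -- Off the diagonal both the induced law and the target vanish, so only diagonal errors remain.
    rw [Fintype.sum_eq_single x fun y hy => ?_]
    · rw [SimulationCode.ofSum_induced π₁ π₂ hd, if_pos rfl, Finset.sum_filter]
      have h := hu fun a => if f a = x then 1 else 0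
      simp only [mul_ite, mul_one, mul_zero] at h
      rw [h, Fintype.card_fin]
      rfl
    · rw [SimulationCode.ofSum_induced π₁ π₂ hd, if_neg hy.symm, zero_sub, abs_neg, abs_eq_zero]
      obtain ⟨i, hi⟩ := Function.ne_iff.1 hy
      refine Finset.prod_eq_zero (Finset.mem_univ i) ?_
      have : q (x i, y i) = 0 := by_contra fun h => hi (hq _ _ h).symm
      simp [this]
  · congr!

theorem achievable_add {α : Type*} [Fintype α] {q : PMF (α × α)}
    (hq : ∀ x y : α, q (x, y) ≠ 0 → x = y) {R R₁ R₂ : ℝ} (hR : 0 ≤ R) (hR₁ : 0 ≤ R₁)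
    (hR₂ : 0 ≤ R₂) (hmin : entropy (q.map Prod.fst) ≤ R + min R₁ R₂)
    (hhalf : entropy (q.map Prod.fst) / 2 ≤ R) {ε : ℝ} (hε : 0 < ε) :
    Achievable q (R + ε) R₁ R₂ := by
  classical
  rw [entropy_map_fst hq] at hmin hhalf
  set H := -∑ a, (q (a, a)).toReal * Real.logb 2 (q (a, a)).toReal with hH
  have hp1 := sum_diag_toReal hq
  have hp0 : ∀ a, 0 ≤ (q (a, a)).toReal := fun a => ENNReal.toReal_nonneg
  -- Capping `t` at `R` keeps the rate left for `V` nonnegative. When the cap is active, `H ≤ 2R`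
  -- replaces the bound with the minimum.
  obtain ⟨t, ht0, ht₁, ht₂, htR, htH⟩ : ∃ t, 0 ≤ t ∧ t ≤ R₁ ∧ t ≤ R₂ ∧ t ≤ R ∧ H ≤ R + t := by
    refine ⟨min R (min R₁ R₂), by positivity, (min_le_right _ _).trans (min_le_left _ _),
      (min_le_right _ _).trans (min_le_right _ _), min_le_left _ _, ?_⟩
    rcases min_choice R (min R₁ R₂) with h | h <;> rw [h] <;> linarith
  have hmono : ∀ (n : ℕ) {a b : ℝ}, a ≤ b → (2 : ℝ) ^ (n * a) ≤ 2 ^ (n * b) := fun n a b hab =>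
    Real.rpow_le_rpow_of_exponent_le one_le_two (by gcongr)
  have hsize : ∀ (n : ℕ) {a b : ℝ}, a ≤ b → indexSize n a ≤ indexSize n b := fun n a b hab =>
    Nat.floor_le_floor (hmono n hab)
  have hsR : 0 ≤ R - t + ε := by linarith
  -- Half of the slack `ε` pays for typicality; the other half makes the quantization error decay.
  let T : (n : ℕ) → Finset (Fin n → α) := fun n =>
    Finset.univ.filter fun x => (2 : ℝ) ^ (-(n * (H + ε / 2))) ≤ ∏ i, (q (x i, x i)).toReal
  have hcode : ∀ n : ℕ, ∃ c : SimulationCode α α n (R + ε) R₁ R₂, c.l1Error q ≤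
      2 * ((T n).card * (4 / ((indexSize n t : ℝ) ^ 2 * (indexSize n (R - t + ε) : ℕ))) +
        ∑ x with x ∉ T n, ∏ i, (q (x i, x i)).toReal) := fun n =>
    exists_code_l1Error_le hq (indexSize_pos ht0) (indexSize_pos hsR) (hsize n ht₁) (hsize n ht₂)
      (Nat.le_floor (by
        push_cast
        refine (mul_le_mul (indexSize_le _ _) (indexSize_le _ _) (Nat.cast_nonneg _)
          (by positivity)).trans (le_of_eq ?_)
        rw [← Real.rpow_add two_pos]
        ring_nf)) (T n)
  choose c hc using hcode
  refine ⟨by linarith, hR₁, hR₂, c, ?_⟩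
  have hlight := tendsto_sum_light_words hp0 hp1 (c := H + ε / 2) (by linarith)
  -- 32 is the 4 from the atom bound times the 8 lost to three floors.
  have hpow : Tendsto (fun n : ℕ => 32 * ((2 : ℝ) ^ (-(ε / 2))) ^ n) atTop (𝓝 (32 * 0)) :=
    (tendsto_pow_atTop_nhds_zero_of_lt_one (by positivity)
      (Real.rpow_lt_one_of_one_lt_of_neg one_lt_two (by linarith))).const_mul 32
  have hlim := (hpow.add hlight).const_mul 2
  simp only [mul_zero, add_zero] at hlim
  refine squeeze_zero (fun n => Finset.sum_nonneg fun x _ => Finset.sum_nonneg fun y _ =>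
    abs_nonneg _) (fun n => (hc n).trans ?_) hlim
  refine mul_le_mul_of_nonneg_left (add_le_add ?_ (le_of_eq ?_)) two_pos.le
  · have hk := rpow_le_two_mul_indexSize (n := n) ht0
    have hK := rpow_le_two_mul_indexSize (n := n) hsR
    have hk0 : (0 : ℝ) < indexSize n t := by exact_mod_cast indexSize_pos ht0
    have hK0 : (0 : ℝ) < indexSize n (R - t + ε) := by exact_mod_cast indexSize_pos hsR
    have hT : ((T n).card : ℝ) ≤ 2 ^ (n * (H + ε / 2)) :=
      card_heavy_le (fun x => Finset.prod_nonneg fun i _ => hp0 _)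
        (by rw [sum_prod_eq_pow (fun a => (q (a, a)).toReal), hp1, one_pow]) _
    have h8 : (2 : ℝ) ^ (n * (H + ε)) ≤
        8 * ((indexSize n t : ℝ) ^ 2 * indexSize n (R - t + ε)) := by
      calc (2 : ℝ) ^ (n * (H + ε)) ≤ 2 ^ (n * (t + t + (R - t + ε))) := hmono n (by linarith)
        _ = 2 ^ (n * t) * 2 ^ (n * t) * 2 ^ (n * (R - t + ε)) := by
            rw [← Real.rpow_add two_pos, ← Real.rpow_add two_pos]
            ring_nf
        _ ≤ (2 * indexSize n t) * (2 * indexSize n t) * (2 * indexSize n (R - t + ε)) := by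
            gcongr
        _ = _ := by ring
    rw [mul_div_assoc', div_le_iff₀ (by positivity)]
    have hsplit : (2 : ℝ) ^ (n * (H + ε / 2)) = (2 ^ (-(ε / 2))) ^ n * 2 ^ (n * (H + ε)) := by
      rw [← Real.rpow_natCast, ← Real.rpow_mul two_pos.le, ← Real.rpow_add two_pos]
      ring_nf
    have hpos : (0 : ℝ) ≤ (2 ^ (-(ε / 2))) ^ n := by positivity
    have := mul_le_mul_of_nonneg_left h8 hpos
    linarith
  · simp [T]

end DistributedSampling

/-! ### The rate region -/

theorem mainTheorem12 {α : Type*} [Fintype α] (q : PMF (α × α))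
    (hq : ∀ x y : α, q (x, y) ≠ 0 → x = y) :
    DistributedSampling.simulationRateRegion q =
      {r : ℝ × ℝ × ℝ | 0 ≤ r.1 ∧ 0 ≤ r.2.1 ∧ 0 ≤ r.2.2 ∧
        DistributedSampling.entropy (q.map Prod.fst) ≤ r.1 + min r.2.1 r.2.2 ∧
        DistributedSampling.entropy (q.map Prod.fst) / 2 ≤ r.1} := by
  refine Set.Subset.antisymm (closure_minimal
    (fun r hr => DistributedSampling.Achievable.mem_region hq hr) ?_) ?_
  · simp only [Set.ofPred_and]
    exact (isClosed_le continuous_const continuous_fst).inter <|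
      (isClosed_le (by fun_prop) (by fun_prop)).inter <|
      (isClosed_le (by fun_prop) (by fun_prop)).inter <|
      (isClosed_le (by fun_prop) (by fun_prop)).inter (isClosed_le (by fun_prop) (by fun_prop))
  · rintro ⟨R, R₁, R₂⟩ ⟨hR, hR₁, hR₂, hmin, hhalf⟩
    have hlim : Tendsto (fun ε : ℝ => (R + ε, R₁, R₂)) (𝓝[>] 0) (𝓝 (R, R₁, R₂)) := by
      have h : Tendsto (fun ε : ℝ => (R + ε, R₁, R₂)) (𝓝 0) (𝓝 (R + 0, R₁, R₂)) :=
        Continuous.tendsto (by fun_prop) 0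
      rw [add_zero] at h
      exact h.mono_left nhdsWithin_le_nhds
    exact mem_closure_of_tendsto hlim (eventually_mem_nhdsWithin.mono fun ε hε =>
      DistributedSampling.achievable_add hq hR hR₁ hR₂ hmin hhalf hε)
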